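/- Let $\mathbb{K}$ be a field (of arbitrary characteristic) with more than $2$ elements, let $n$ be a non-negative integer, and let $S_n(\mathbb{K})$ denote the space of all symmetric $n\times n$ matrices with entries in $\mathbb{K}$. Let $\mathcal{S}$ be a linear subspace of $S_n(\mathbb{K})$ whose codimension in $S_n(\mathbb{K})$ is at most $n-2$, and identify each matrix $M$ of $\mathcal{S}$ with the endomorphism $X \mapsto MX$ of $\mathbb{K}^n$. Let $F : \mathcal{S} \to \mathbb{K}^n$ be a linear map that is range-compatible, i.e. $F(M)\in \operatorname{im} M$ for all $M \in \mathcal{S}$. Then $F$ is local, i.e. there exists a vector $x \in \mathbb{K}^n$ such that $F(M)=Mx$ for all $M\in\mathcal{S}$. -/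

import Mathlib

/-- The linear subspace of `Matrix (Fin n) (Fin n) K` consisting of the symmetric matrices. -/
def symmetricMatrices (K : Type*) [Field K] (n : ℕ) :
    Submodule K (Matrix (Fin n) (Fin n) K) where
  carrier := {M | M.IsSymm}
  add_mem' := fun hA hB => Matrix.IsSymm.add hA hB
  zero_mem' := Matrix.isSymm_zero
  smul_mem' := fun c _ hA => Matrix.IsSymm.smul hA c

/-- The codimension of a linear subspace `S` of a vector space `W` inside a linear subspace `T`
of `W`: the dimension of the quotient of `T` by `S` (meant for `S ≤ T`). -/
noncomputable def codimIn {K W : Type*} [Field K] [AddCommGroup W] [Module K W]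
    (S T : Submodule K W) : ℕ :=
  Module.finrank K (T ⧸ S.submoduleOf T)

/-- A map `F` from a set `S` of linear maps from `U` to `V` into `V` is range-compatible when
`F s` belongs to the range of `s` for all `s` in `S`. -/
def IsRangeCompatible {K U V : Type*} [Field K] [AddCommGroup U] [Module K U]
    [AddCommGroup V] [Module K V] {S : Set (U →ₗ[K] V)} (F : S → V) : Prop :=
  ∀ s : S, F s ∈ LinearMap.range (s : U →ₗ[K] V)

/-- A map `F` from a set `S` of linear maps from `U` to `V` into `V` is local when it is the
evaluation at some vector `x` of `U`. -/
def IsLocalMap {K U V : Type*} [Field K] [AddCommGroup U] [Module K U]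
    [AddCommGroup V] [Module K V] {S : Set (U →ₗ[K] V)} (F : S → V) : Prop :=
  ∃ x : U, ∀ s : S, F s = (s : U →ₗ[K] V) x

/-- A linear subspace of `n` by `n` matrices seen as a linear subspace of the space of
endomorphisms of `Fin n → K`, through the canonical basis. -/
def operatorSpace {K : Type*} [Field K] {n : ℕ} (S : Submodule K (Matrix (Fin n) (Fin n) K)) :
    Submodule K ((Fin n → K) →ₗ[K] (Fin n → K)) :=
  S.map (Matrix.toLin' : Matrix (Fin n) (Fin n) K ≃ₗ[K] _).toLinearMap

/-! Linear forms on symmetric matrices correspond, in every characteristic, to quadratic forms: `M ↦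
y ⬝ᵥ M x` becomes the product of the linear forms of `y` and `x`. Let `D` be the image of the
annihilator of the subspace, so `dim D ≤ n - 2`, and let `φ y` represent `y ⬝ᵥ F M`. By symmetry,
range-compatibility says that each `φ y` is `y * x` modulo `D`, with `x` depending on `y`; locality
asks for one `x` (`exists_eq_mul_mod`).

The induction runs over subspaces `W` of vectors `y`, on a bound for `dim (D ⊓ mulLinForms W)`. When
this intersection is zero, unique factorization forces a common `x`. Otherwise a nonzero `q` in it
and a point `p` with `q(p) ≠ 0` give the hyperplane of `W` orthogonal to `p`, where the intersection
is smaller. Two such hyperplanes yield multipliers `x₁`, `x₂`. If they agree, they glue; if not, the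
multiples of `x₁ - x₂` exhaust the intersection and factorization gives a contradiction. -/

open MvPolynomial

/-- The linear form with coefficient vector `y`, as a polynomial. -/
noncomputable def linForm (K : Type*) [Field K] (n : ℕ) : (Fin n → K) →ₗ[K] MvPolynomial (Fin n) K :=
  Fintype.linearCombination K X

/-! ### Products of linear forms and their zeros -/

section LinearForms

variable {K : Type*} [Field K] {n : ℕ}

lemma linForm_apply (y : Fin n → K) : linForm K n y = ∑ i, y i • X i :=
  Fintype.linearCombination_apply ..

lemma eval_linForm (p y : Fin n → K) : eval p (linForm K n y) = y ⬝ᵥ p := by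
  simp [linForm_apply, smul_eval, dotProduct]

lemma isHomogeneous_linForm (y : Fin n → K) : (linForm K n y).IsHomogeneous 1 := by
  rw [linForm_apply]
  refine IsHomogeneous.sum _ _ _ fun i _ => ?_
  rw [smul_eq_C_mul]
  simpa using (isHomogeneous_C (Fin n) (y i)).mul (isHomogeneous_X K i)

lemma linForm_injective : Function.Injective (linForm K n) := by
  intro y z h
  ext i
  simpa [eval_linForm] using congrArg (eval (Pi.single i 1)) h

lemma linForm_ne_zero {y : Fin n → K} (hy : y ≠ 0) : linForm K n y ≠ 0 :=
  (map_ne_zero_iff _ linForm_injective).2 hy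

lemma prime_linForm {y : Fin n → K} (hy : y ≠ 0) : Prime (linForm K n y) := by
  rw [← irreducible_iff_prime]
  refine irreducible_of_totalDegree_eq_one
    ((isHomogeneous_linForm y).totalDegree (linForm_ne_zero hy)) fun c hc => ?_
  refine isUnit_iff_ne_zero.2 ?_
  rintro rfl
  exact linForm_ne_zero hy (MvPolynomial.ext _ _ fun i => by simpa using hc i)

lemma eq_smul_of_linForm_dvd {y v : Fin n → K} (hy : y ≠ 0)
    (h : linForm K n y ∣ linForm K n v) : ∃ c : K, v = c • y := by
  obtain ⟨r, hr⟩ := h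
  rcases eq_or_ne v 0 with rfl | hv
  · exact ⟨0, by simp⟩
  have hr0 : r ≠ 0 := by
    rintro rfl
    exact linForm_ne_zero hv (by simpa using hr)
  have hdeg := congrArg totalDegree hr
  rw [totalDegree_mul_of_isDomain (linForm_ne_zero hy) hr0,
    (isHomogeneous_linForm y).totalDegree (linForm_ne_zero hy),
    (isHomogeneous_linForm v).totalDegree (linForm_ne_zero hv)] at hdeg
  refine ⟨coeff 0 r, linForm_injective ?_⟩
  rw [hr, map_smul, smul_eq_C_mul, ← totalDegree_eq_zero_iff_eq_C.1 (by lia), mul_comm]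

/-- Unique factorization: the form of `y` is prime and not associated to that of `z`, so it divides
that of `w`. -/
lemma eq_smul_of_linForm_mul_eq {y z v w : Fin n → K} (hz : z ≠ 0) (hyz : ∀ c : K, y ≠ c • z)
    (h : linForm K n y * linForm K n v = linForm K n z * linForm K n w) :
    ∃ c : K, w = c • y ∧ v = c • z := by
  have hy : y ≠ 0 := by simpa using hyz 0
  rcases (prime_linForm hy).dvd_or_dvd (Dvd.intro _ h) with h1 | h1
  · obtain ⟨c, rfl⟩ := eq_smul_of_linForm_dvd hy h1
    have hc : c ≠ 0 := by
      rintro rfl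
      simp at hz
    exact absurd (by simp [hc]) (hyz c⁻¹)
  · obtain ⟨c, rfl⟩ := eq_smul_of_linForm_dvd hy h1
    refine ⟨c, rfl, linForm_injective (mul_left_cancel₀ (linForm_ne_zero hy) ?_)⟩
    rw [h, map_smul, map_smul, mul_smul_comm, mul_smul_comm, mul_comm]

/-- The space of quadratic forms generated by the products of a linear form of `W` with an
arbitrary linear form. -/
noncomputable def mulLinForms (W : Submodule K (Fin n → K)) :
    Submodule K (MvPolynomial (Fin n) K) :=
  W.map (linForm K n) * LinearMap.range (linForm K n)

lemma linForm_mul_mem {W : Submodule K (Fin n → K)} {y : Fin n → K} (hy : y ∈ W)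
    (x : Fin n → K) : linForm K n y * linForm K n x ∈ mulLinForms W :=
  Submodule.mul_mem_mul (Submodule.mem_map_of_mem hy) ⟨x, rfl⟩

lemma mulLinForms_mono {W W' : Submodule K (Fin n → K)} (h : W ≤ W') :
    mulLinForms W ≤ mulLinForms W' :=
  mul_le_mul' (Submodule.map_mono h) le_rfl

lemma mulLinForms_induction {W : Submodule K (Fin n → K)} {P : MvPolynomial (Fin n) K → Prop}
    (hmul : ∀ y ∈ W, ∀ x, P (linForm K n y * linForm K n x))
    (hadd : ∀ p q, P p → P q → P (p + q)) {q : MvPolynomial (Fin n) K}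
    (hq : q ∈ mulLinForms W) : P q := by
  refine Submodule.mul_induction_on hq ?_ hadd
  rintro _ ⟨y, hy, rfl⟩ _ ⟨x, rfl⟩
  exact hmul y hy x

instance finite_mulLinForms (W : Submodule K (Fin n → K)) :
    FiniteDimensional K (mulLinForms W) :=
  Module.Finite.iff_fg.2 (Submodule.FG.mul (Module.Finite.iff_fg.1 inferInstance)
    (Module.Finite.iff_fg.1 inferInstance))

lemma isHomogeneous_of_mem_mulLinForms {W : Submodule K (Fin n → K)}
    {q : MvPolynomial (Fin n) K} (hq : q ∈ mulLinForms W) : q.IsHomogeneous 2 :=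
  mulLinForms_induction (P := fun q => q.IsHomogeneous 2)
    (fun y _ x => (isHomogeneous_linForm y).mul (isHomogeneous_linForm x))
    (fun _ _ => IsHomogeneous.add) hq

lemma eval_add_smul_of_mem_mulLinForms {W : Submodule K (Fin n → K)}
    {q : MvPolynomial (Fin n) K} (hq : q ∈ mulLinForms W) (p g : Fin n → K) :
    ∃ b : K, ∀ a : K, eval (p + a • g) q = eval p q + a * b + a ^ 2 * eval g q := by
  refine mulLinForms_induction (P := fun q => ∃ b : K, ∀ a : K,
    eval (p + a • g) q = eval p q + a * b + a ^ 2 * eval g q) ?_ ?_ hq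
  · intro y _ x
    refine ⟨(y ⬝ᵥ p) * (x ⬝ᵥ g) + (y ⬝ᵥ g) * (x ⬝ᵥ p), fun a => ?_⟩
    simp only [map_mul, eval_linForm, dotProduct_add, dotProduct_smul, smul_eq_mul]
    ring
  · rintro q r ⟨b, hb⟩ ⟨c, hc⟩
    refine ⟨b + c, fun a => ?_⟩
    rw [map_add, hb, hc, map_add, map_add]
    ring

/-- The vectors of `W` that are orthogonal to `p`. -/
def orthIn (W : Submodule K (Fin n → K)) (p : Fin n → K) : Submodule K (Fin n → K) :=
  W ⊓ LinearMap.ker (dotProductBilin K K p)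

lemma mem_orthIn {W : Submodule K (Fin n → K)} {p w : Fin n → K} :
    w ∈ orthIn W p ↔ w ∈ W ∧ w ⬝ᵥ p = 0 := by
  simp [orthIn, dotProduct_comm p w]

lemma finrank_le_finrank_inf_ker_add_one {V : Type*} [AddCommGroup V] [Module K V]
    [FiniteDimensional K V] (W : Submodule K V) (f : Module.Dual K V) :
    Module.finrank K W ≤ Module.finrank K (W ⊓ LinearMap.ker f : Submodule K V) + 1 := by
  have h1 := Submodule.finrank_sup_add_finrank_inf_eq W (LinearMap.ker f)
  have h2 := f.finrank_range_add_finrank_ker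
  have h3 := Submodule.finrank_le (LinearMap.range f)
  have h4 := Submodule.finrank_le (W ⊔ LinearMap.ker f)
  rw [Module.finrank_self] at h3
  lia

lemma finrank_le_finrank_orthIn_add_one (W : Submodule K (Fin n → K)) (p : Fin n → K) :
    Module.finrank K W ≤ Module.finrank K (orthIn W p) + 1 :=
  finrank_le_finrank_inf_ker_add_one W _

/-- This makes the induction descend: a form with `q(p) ≠ 0` is lost on passing to `orthIn W p`. -/
lemma eval_eq_zero_of_mem_mulLinForms_orthIn {W : Submodule K (Fin n → K)} {p : Fin n → K}
    {q : MvPolynomial (Fin n) K} (hq : q ∈ mulLinForms (orthIn W p)) : eval p q = 0 := by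
  refine mulLinForms_induction (P := fun q => eval p q = 0) ?_ ?_ hq
  · intro y hy x
    simp [eval_linForm, (mem_orthIn.1 hy).2]
  · intro q r h1 h2
    simp [h1, h2]

lemma exists_dotProduct_ne_zero_of_eval_ne_zero {W : Submodule K (Fin n → K)} {p : Fin n → K}
    {q : MvPolynomial (Fin n) K} (hq : q ∈ mulLinForms W) (h : eval p q ≠ 0) :
    ∃ w ∈ W, w ⬝ᵥ p ≠ 0 := by
  by_contra! hW
  have : orthIn W p = W := by
    ext w
    simpa [mem_orthIn] using hW w
  exact h (eval_eq_zero_of_mem_mulLinForms_orthIn (W := W) (by rwa [this]))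

lemma exists_ne_zero_ne_one (hK : 2 < ENat.card K) : ∃ c : K, c ≠ 0 ∧ c ≠ 1 := by
  by_contra! h
  have : (Set.univ : Set K) ⊆ {0, 1} := fun c _ => by
    by_cases hc : c = 0
    · simp [hc]
    · simp [h c hc]
  have h1 := Set.encard_le_encard this
  rw [Set.encard_univ, Set.encard_pair zero_ne_one] at h1
  exact absurd hK (not_lt.2 h1)

lemma exists_eval_ne_zero {c : K} (hc0 : c ≠ 0) (hc1 : c ≠ 1) {W : Submodule K (Fin n → K)}
    {q : MvPolynomial (Fin n) K} (hq : q ∈ mulLinForms W) (hq0 : q ≠ 0) :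
    ∃ p, eval p q ≠ 0 := by
  classical
  by_contra! h
  -- Degree at most 2 in each variable requires three grid values, hence the third scalar `c`.
  refine hq0 (eq_zero_of_eval_zero_at_prod_finset q (fun _ => {0, 1, c}) (fun i => ?_)
    fun x _ => h x)
  have h1 := degreeOf_le_totalDegree q i
  rw [(isHomogeneous_of_mem_mulLinForms hq).totalDegree hq0] at h1
  rw [Finset.card_eq_three.2 ⟨0, 1, c, zero_ne_one, hc0.symm, hc1.symm, rfl⟩]
  lia

/-- A nonzero quadratic form in `mulLinForms W` does not vanish at some two points that define
different hyperplanes of `W`. -/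
lemma exists_pair_eval_ne_zero {c : K} (hc0 : c ≠ 0) (hc1 : c ≠ 1)
    {W : Submodule K (Fin n → K)} (hW : 2 ≤ Module.finrank K W)
    {q : MvPolynomial (Fin n) K} (hq : q ∈ mulLinForms W) (hq0 : q ≠ 0) :
    ∃ p₁ p₂ w₁ w₂, eval p₁ q ≠ 0 ∧ eval p₂ q ≠ 0 ∧ w₁ ∈ W ∧ w₂ ∈ W ∧
      w₁ ⬝ᵥ p₁ = 0 ∧ w₁ ⬝ᵥ p₂ ≠ 0 ∧ w₂ ⬝ᵥ p₁ ≠ 0 ∧ w₂ ⬝ᵥ p₂ = 0 := by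
  obtain ⟨p, hp⟩ := exists_eval_ne_zero hc0 hc1 hq hq0
  have hr := finrank_le_finrank_orthIn_add_one W p
  have hne : orthIn W p ≠ ⊥ := by
    intro h
    rw [h, finrank_bot] at hr
    lia
  obtain ⟨w, hw, hw0⟩ := Submodule.exists_mem_ne_zero_of_ne_bot hne
  rw [mem_orthIn] at hw
  obtain ⟨g, hg⟩ : ∃ g, w ⬝ᵥ g ≠ 0 := by
    by_contra! h
    exact hw0 (dotProduct_eq_zero_iff.1 h)
  -- Otherwise `q` vanishes off the hyperplane `w ⬝ᵥ p' = 0`. On the line `p + a • g` it is then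
  -- affine in `a` with roots `1` and `c`, so `q(p) = 0`.
  obtain ⟨p', hp', hwp'⟩ : ∃ p', eval p' q ≠ 0 ∧ w ⬝ᵥ p' ≠ 0 := by
    by_contra! h
    obtain ⟨b, hb⟩ := eval_add_smul_of_mem_mulLinForms hq p g
    have hg0 : eval g q = 0 := by
      by_contra h0
      exact hg (h g h0)
    have hz : ∀ a : K, a ≠ 0 → eval p q + a * b = 0 := by
      intro a ha
      by_contra h0
      have := h (p + a • g) (by rwa [hb, hg0, mul_zero, add_zero])
      rw [dotProduct_add, hw.2, zero_add, dotProduct_smul, smul_eq_mul] at this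
      exact mul_ne_zero ha hg this
    have h1 := hz 1 one_ne_zero
    have h2 := hz c hc0
    have hb0 : (c - 1) * b = 0 := by linear_combination h2 - h1
    rcases mul_eq_zero.1 hb0 with h3 | h3
    · exact hc1 (sub_eq_zero.1 h3)
    · rw [h3, mul_zero, add_zero] at h1
      exact hp h1
  obtain ⟨v, hv, hvp⟩ := exists_dotProduct_ne_zero_of_eval_ne_zero hq hp
  refine ⟨p, p', w, v - (v ⬝ᵥ p' / w ⬝ᵥ p') • w, hp, hp', hw.1,
    W.sub_mem hv (W.smul_mem _ hw.1), hw.2, hwp', ?_, ?_⟩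
  · simpa [sub_dotProduct, smul_dotProduct, hw.2] using hvp
  · simp [sub_dotProduct, smul_dotProduct, hwp']

end LinearForms

/-! ### The polynomial theorem, by induction on the dimension of the intersection -/

section Core

variable {K : Type*} [Field K] {n : ℕ}

/-- The case of the polynomial theorem where `D` contains no nonzero element of
`mulLinForms W`. -/
lemma exists_eq_mul_of_disjoint {c : K} (hc0 : c ≠ 0) (hc1 : c ≠ 1)
    {D : Submodule K (MvPolynomial (Fin n) K)}
    (φ : (Fin n → K) →ₗ[K] MvPolynomial (Fin n) K) (W : Submodule K (Fin n → K))
    (hφ : ∀ y ∈ W, ∃ x, φ y - linForm K n y * linForm K n x ∈ D)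
    (hD : D ⊓ mulLinForms W = ⊥) (hW : 2 ≤ Module.finrank K W) :
    ∃ x, ∀ y ∈ W, φ y - linForm K n y * linForm K n x ∈ D := by
  choose! x hx using hφ
  have key : ∀ y ∈ W, ∀ z ∈ W, z ≠ 0 → (∀ a : K, y ≠ a • z) → x y = x z := by
    intro y hy z hz hz0 hyz
    have hstep : ∀ a : K, a ≠ 0 → ∃ b : K, x z - x y = b • (y + a • z) := by
      intro a ha
      have haz : a • z ∈ W := W.smul_mem a hz
      have hyaz : y + a • z ∈ W := W.add_mem hy haz
      have hmem : linForm K n (y + a • z) * linForm K n (x (y + a • z))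
          - linForm K n y * linForm K n (x y) - linForm K n (a • z) * linForm K n (x z)
            ∈ D ⊓ mulLinForms W := by
        refine Submodule.mem_inf.2 ⟨?_, sub_mem (sub_mem (linForm_mul_mem hyaz _) (linForm_mul_mem hy _))
          (linForm_mul_mem haz _)⟩
        have h := D.sub_mem (D.add_mem (hx y hy) (D.smul_mem a (hx z hz))) (hx _ hyaz)
        convert h using 1
        simp only [map_add, map_smul, smul_sub, smul_mul_assoc]
        ring
      rw [hD, Submodule.mem_bot] at hmem
      have heq : linForm K n y * linForm K n (x (y + a • z) - x y)
          = linForm K n (a • z) * linForm K n (x z - x (y + a • z)) := by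
        rw [map_sub, map_sub]
        rw [map_add (linForm K n) y] at hmem
        linear_combination hmem
      obtain ⟨b, h1, h2⟩ := eq_smul_of_linForm_mul_eq (smul_ne_zero ha hz0)
        (fun b => by rw [smul_smul]; exact hyz _) heq
      exact ⟨b, by rw [smul_add, ← h1, ← h2]; abel⟩
    -- The vector `x z - x y` is a multiple of both `y + z` and `y + c • z`, which are independent,
    -- so it is zero.
    obtain ⟨b, hb⟩ := hstep 1 one_ne_zero
    obtain ⟨d, hd⟩ := hstep c hc0
    have hbd : (b - d) • y = (d * c - b) • z := by
      have h := hb.symm.trans hd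
      rw [one_smul, smul_add, smul_add] at h
      rw [sub_smul, sub_smul, mul_smul, sub_eq_sub_iff_add_eq_add, h, add_comm]
    have hbd0 : b = d := by
      by_contra h
      refine hyz ((b - d)⁻¹ * (d * c - b)) ?_
      rw [mul_smul, ← hbd, smul_smul, inv_mul_cancel₀ (sub_ne_zero.2 h), one_smul]
    subst hbd0
    rw [sub_self, zero_smul] at hbd
    have hb0 : b * (c - 1) = 0 := by
      have := (smul_eq_zero.1 hbd.symm).resolve_right hz0
      linear_combination this
    have hb00 : b = 0 := (mul_eq_zero.1 hb0).resolve_right (sub_ne_zero.2 hc1)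
    rw [hb00, zero_smul] at hb
    exact (sub_eq_zero.1 hb).symm
  have hne : W ≠ ⊥ := by
    rintro rfl
    simp at hW
  obtain ⟨z, hz, hz0⟩ := Submodule.exists_mem_ne_zero_of_ne_bot hne
  refine ⟨x z, fun y hy => ?_⟩
  by_cases h : ∃ a : K, y = a • z
  · obtain ⟨a, rfl⟩ := h
    simpa [smul_sub] using D.smul_mem a (hx z hz)
  · rw [← key y hy z hz hz0 (not_exists.1 h)]
    exact hx y hy

/-- If `φ` is multiplication by `x₁` on one hyperplane of `W` and by `x₂ ≠ x₁` on another, then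
the multiples of `x₁ - x₂` cannot fill the whole of `D ⊓ mulLinForms W`. -/
lemma false_of_two_multipliers {D : Submodule K (MvPolynomial (Fin n) K)}
    (φ : (Fin n → K) →ₗ[K] MvPolynomial (Fin n) K) {W : Submodule K (Fin n → K)}
    (hφ : ∀ y ∈ W, ∃ x, φ y - linForm K n y * linForm K n x ∈ D)
    {p₁ p₂ x₁ x₂ w₁ w₂ u₀ : Fin n → K} (hx : x₁ ≠ x₂)
    (h₁ : ∀ y ∈ orthIn W p₁, φ y - linForm K n y * linForm K n x₁ ∈ D)
    (h₂ : ∀ y ∈ orthIn W p₂, φ y - linForm K n y * linForm K n x₂ ∈ D)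
    (hD : ∀ q ∈ D ⊓ mulLinForms W, ∃ u ∈ orthIn W p₁ ⊓ orthIn W p₂,
      q = linForm K n (x₁ - x₂) * linForm K n u)
    (hu₀ : u₀ ∈ orthIn W p₁ ⊓ orthIn W p₂) (hu₀0 : u₀ ≠ 0)
    (hw₁ : w₁ ∈ orthIn W p₁) (hw₂ : w₂ ∈ orthIn W p₂)
    (hw₁p₂ : w₁ ⬝ᵥ p₂ ≠ 0) (hw₂p₁ : w₂ ⬝ᵥ p₁ ≠ 0) : False := by
  have hz : x₁ - x₂ ≠ 0 := sub_ne_zero.2 hx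
  have key : ∀ y ∈ orthIn W p₁, y ⬝ᵥ p₂ ≠ 0 → ∃ a : K, y + w₂ = a • (x₁ - x₂) := by
    intro y hy hyp
    by_contra! hmul
    have hyW : y ∈ W := (mem_orthIn.1 hy).1
    have hwW : w₂ ∈ W := (mem_orthIn.1 hw₂).1
    obtain ⟨x, hx⟩ := hφ (y + w₂) (W.add_mem hyW hwW)
    obtain ⟨u, hu, hq⟩ := hD (linForm K n y * linForm K n x₁ + linForm K n w₂ * linForm K n x₂
        - linForm K n (y + w₂) * linForm K n x) (Submodule.mem_inf.2 ⟨by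
      have h := D.sub_mem hx (D.add_mem (h₁ y hy) (h₂ w₂ hw₂))
      convert h using 1
      rw [map_add φ]
      ring, sub_mem (add_mem (linForm_mul_mem hyW _) (linForm_mul_mem hwW _))
        (linForm_mul_mem (W.add_mem hyW hwW) _)⟩)
    have heq : linForm K n (y + w₂) * linForm K n (x₁ - x)
        = linForm K n (x₁ - x₂) * linForm K n (u + w₂) := by
      simp only [map_add, map_sub] at hq ⊢
      linear_combination hq
    obtain ⟨a, ha, -⟩ := eq_smul_of_linForm_mul_eq hz hmul heq
    -- In `u + w₂ = a • (y + w₂)`, pairing with `p₁` gives `a = 1` and pairing with `p₂` gives `a =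
    -- 0`.
    have hd₁ := congrArg (· ⬝ᵥ p₁) ha
    have hd₂ := congrArg (· ⬝ᵥ p₂) ha
    simp only [add_dotProduct, smul_dotProduct, smul_eq_mul, (mem_orthIn.1 hu.1).2,
      (mem_orthIn.1 hu.2).2, (mem_orthIn.1 hy).2, (mem_orthIn.1 hw₂).2, zero_add, add_zero]
      at hd₁ hd₂
    have ha1 : (a - 1) * (w₂ ⬝ᵥ p₁) = 0 := by linear_combination -hd₁
    have ha1' := (mul_eq_zero.1 ha1).resolve_right hw₂p₁
    have ha0 := (mul_eq_zero.1 hd₂.symm).resolve_right hyp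
    rw [ha0, zero_sub, neg_eq_zero] at ha1'
    exact one_ne_zero ha1'
  obtain ⟨a, ha⟩ := key w₁ hw₁ hw₁p₂
  -- Shifting `w₁` by `u₀` puts `u₀`, and with it `w₁ + w₂`, on the line of `x₁ - x₂`; but `p₁`
  -- kills `u₀` and not `w₁ + w₂`.
  obtain ⟨b, hb⟩ := key (w₁ + u₀) (add_mem hw₁ hu₀.1) (by
    rwa [add_dotProduct, (mem_orthIn.1 hu₀.2).2, add_zero])
  have hu : u₀ = (b - a) • (x₁ - x₂) := by
    rw [sub_smul, ← ha, ← hb]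
    abel
  have hba : b - a ≠ 0 := by
    intro h
    rw [h, zero_smul] at hu
    exact hu₀0 hu
  have hw : w₁ + w₂ = (a * (b - a)⁻¹) • u₀ := by
    rw [ha, hu, smul_smul, mul_assoc, inv_mul_cancel₀ hba, mul_one]
  have h := congrArg (· ⬝ᵥ p₁) hw
  simp only [add_dotProduct, smul_dotProduct, (mem_orthIn.1 hw₁).2, (mem_orthIn.1 hu₀.1).2,
    zero_add, smul_zero] at h
  exact hw₂p₁ h

/-- Passing to a hyperplane of `W` costs one dimension of `W` and at least one of the intersection,
so the margin of 2 persists. -/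
theorem exists_eq_mul_mod {c : K} (hc0 : c ≠ 0) (hc1 : c ≠ 1)
    {D : Submodule K (MvPolynomial (Fin n) K)}
    (φ : (Fin n → K) →ₗ[K] MvPolynomial (Fin n) K) (d : ℕ) :
    ∀ W : Submodule K (Fin n → K),
      (∀ y ∈ W, ∃ x, φ y - linForm K n y * linForm K n x ∈ D) →
      Module.finrank K (D ⊓ mulLinForms W : Submodule K _) ≤ d → d + 2 ≤ Module.finrank K W →
      ∃ x, ∀ y ∈ W, φ y - linForm K n y * linForm K n x ∈ D := by
  have hfin : ∀ W : Submodule K (Fin n → K),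
      FiniteDimensional K (D ⊓ mulLinForms W : Submodule K _) := fun W =>
    Submodule.finiteDimensional_of_le inf_le_right
  induction d with
  | zero =>
    intro W hφ hd hW
    exact exists_eq_mul_of_disjoint hc0 hc1 φ W hφ
      (Submodule.finrank_eq_zero.1 (Nat.le_zero.1 hd)) hW
  | succ d ih =>
    intro W hφ hd hW
    rcases Nat.lt_or_ge (Module.finrank K (D ⊓ mulLinForms W : Submodule K _)) (d + 1) with
      hlt | hge
    · exact ih W hφ (by lia) (by lia)
    have hne : D ⊓ mulLinForms W ≠ ⊥ := by
      intro h
      rw [h, finrank_bot] at hge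
      lia
    obtain ⟨q, hq, hq0⟩ := Submodule.exists_mem_ne_zero_of_ne_bot hne
    obtain ⟨p₁, p₂, w₁, w₂, hp₁, hp₂, hw₁, hw₂, h11, h12, h21, h22⟩ :=
      exists_pair_eval_ne_zero hc0 hc1 (by lia) hq.2 hq0
    have hle : ∀ p, orthIn W p ≤ W := fun p => inf_le_left
    have hrestrict : ∀ p, eval p q ≠ 0 →
        ∃ x, ∀ y ∈ orthIn W p, φ y - linForm K n y * linForm K n x ∈ D := by
      intro p hp
      refine ih _ (fun y hy => hφ y (hle p hy)) ?_ ?_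
      · have hlt : D ⊓ mulLinForms (orthIn W p) < D ⊓ mulLinForms W := by
          refine lt_of_le_of_ne (inf_le_inf_left _ (mulLinForms_mono (hle p))) fun h => ?_
          rw [← h] at hq
          exact hp (eval_eq_zero_of_mem_mulLinForms_orthIn hq.2)
        have := Submodule.finrank_lt_finrank_of_lt hlt
        lia
      · have := finrank_le_finrank_orthIn_add_one W p
        lia
    obtain ⟨x₁, hx₁⟩ := hrestrict p₁ hp₁
    obtain ⟨x₂, hx₂⟩ := hrestrict p₂ hp₂
    by_cases hx : x₁ = x₂
    · subst hx
      refine ⟨x₁, fun y hy => ?_⟩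
      -- The two hyperplanes span `W`: `w₁` lies in the first and not in the second.
      have h := D.add_mem (D.smul_mem (y ⬝ᵥ p₂ / w₁ ⬝ᵥ p₂) (hx₁ w₁ (mem_orthIn.2 ⟨hw₁, h11⟩)))
        (hx₂ (y - (y ⬝ᵥ p₂ / w₁ ⬝ᵥ p₂) • w₁) (mem_orthIn.2
          ⟨W.sub_mem hy (W.smul_mem _ hw₁), by simp [sub_dotProduct, smul_dotProduct, h12]⟩))
      convert h using 1
      simp only [map_sub, map_smul, smul_sub, sub_mul, smul_mul_assoc]
      ring
    · exfalso
      have hz := sub_ne_zero.2 hx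
      have hUrank : d + 1 ≤ Module.finrank K (orthIn W p₁ ⊓ orthIn W p₂ : Submodule K _) := by
        have h1 := finrank_le_finrank_orthIn_add_one W p₁
        have h2 := finrank_le_finrank_orthIn_add_one (orthIn W p₁) p₂
        have h3 : orthIn (orthIn W p₁) p₂ = orthIn W p₁ ⊓ orthIn W p₂ := by
          ext w
          simp only [mem_orthIn, Submodule.mem_inf]
          tauto
        rw [h3] at h2
        lia
      have hUne : orthIn W p₁ ⊓ orthIn W p₂ ≠ ⊥ := by
        intro h
        rw [h, finrank_bot] at hUrank
        lia
      obtain ⟨u₀, hu₀, hu₀0⟩ := Submodule.exists_mem_ne_zero_of_ne_bot hUne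
      -- Subtracting the two congruences puts these products in `D`. They form a space of dimension
      -- at least `d + 1`, hence all of `D ⊓ mulLinForms W`.
      let m : (Fin n → K) →ₗ[K] MvPolynomial (Fin n) K :=
        LinearMap.mulLeft K (linForm K n (x₁ - x₂)) ∘ₗ linForm K n
      have hm : Function.Injective m := fun a b hab =>
        linForm_injective (mul_left_cancel₀ (linForm_ne_zero hz) hab)
      have hmap : (orthIn W p₁ ⊓ orthIn W p₂).map m = D ⊓ mulLinForms W := by
        refine Submodule.eq_of_le_of_finrank_le ?_ ?_
        · rintro _ ⟨u, hu, rfl⟩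
          refine Submodule.mem_inf.2 ⟨?_, ?_⟩
          · have h := D.sub_mem (hx₂ u hu.2) (hx₁ u hu.1)
            convert h using 1
            simp only [m, LinearMap.comp_apply, LinearMap.mulLeft_apply, map_sub]
            ring
          · have h := linForm_mul_mem (hle p₁ hu.1) (x₁ - x₂)
            rwa [mul_comm] at h
        · rw [← (Submodule.equivMapOfInjective m hm _).finrank_eq]
          lia
      refine false_of_two_multipliers φ hφ hx hx₁ hx₂ (fun q hq => ?_) hu₀ hu₀0
        (mem_orthIn.2 ⟨hw₁, h11⟩) (mem_orthIn.2 ⟨hw₂, h22⟩) h12 h21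
      rw [← hmap] at hq
      obtain ⟨u, hu, rfl⟩ := hq
      exact ⟨u, hu, rfl⟩

end Core

/-! ### Quadratic forms as the dual of symmetric matrices -/

section Duality

variable {K : Type*} [Field K] {n : ℕ}

/-- The symmetric matrix whose nonzero entries are ones at the positions in `s`. -/
def symUnit (K : Type*) [Field K] {n : ℕ} (s : Sym2 (Fin n)) : symmetricMatrices K n :=
  ⟨Matrix.of fun i j => if s(i, j) = s then 1 else 0, Matrix.ext fun i j => by
    simp [Sym2.eq_swap]⟩

lemma symUnit_apply (s : Sym2 (Fin n)) (i j : Fin n) :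
    (symUnit K s : Matrix (Fin n) (Fin n) K) i j = if s(i, j) = s then 1 else 0 := rfl

/-- The quadratic form that represents a linear form on the space of symmetric matrices. -/
noncomputable def dualToQuadratic (K : Type*) [Field K] (n : ℕ) :
    Module.Dual K (symmetricMatrices K n) →ₗ[K] MvPolynomial (Fin n) K where
  toFun f := ∑ s : Sym2 (Fin n), f (symUnit K s) • (s.map X).mul
  map_add' f g := by simp [add_smul, Finset.sum_add_distrib]
  map_smul' c f := by simp [mul_smul, Finset.smul_sum]

lemma dualToQuadratic_apply (f : Module.Dual K (symmetricMatrices K n)) :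
    dualToQuadratic K n f = ∑ s : Sym2 (Fin n), f (symUnit K s) • (s.map X).mul := rfl

/-- The linear form `M ↦ y ⬝ᵥ M *ᵥ x` on the space of symmetric matrices. -/
def pairing (y x : Fin n → K) : Module.Dual K (symmetricMatrices K n) where
  toFun M := y ⬝ᵥ (M : Matrix (Fin n) (Fin n) K).mulVec x
  map_add' M N := by simp [Matrix.add_mulVec]
  map_smul' c M := by simp [Matrix.smul_mulVec]

lemma dualToQuadratic_pairing (y x : Fin n → K) :
    dualToQuadratic K n (pairing y x) = linForm K n y * linForm K n x := by
  have h : ∀ s : Sym2 (Fin n), pairing y x (symUnit K s)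
      = ∑ i, ∑ j, if s(i, j) = s then y i * x j else 0 := by
    intro s
    simp [pairing, dotProduct, Matrix.mulVec, symUnit_apply, Finset.mul_sum]
  simp only [dualToQuadratic_apply, h, Finset.sum_smul, linForm_apply, Finset.sum_mul_sum]
  rw [Finset.sum_comm]
  refine Finset.sum_congr rfl fun i _ => ?_
  rw [Finset.sum_comm]
  refine Finset.sum_congr rfl fun j _ => ?_
  simp only [ite_smul, zero_smul, Finset.sum_ite_eq, Finset.mem_univ, if_true]
  simp [mul_smul, smul_comm (x j)]

lemma symMonomial_eq (a b : Fin n) : ((s(a, b) : Sym2 (Fin n)).map X).mul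
    = (monomial (Finsupp.single a 1 + Finsupp.single b 1) 1 : MvPolynomial (Fin n) K) := by
  simp [X, monomial_mul]

lemma coeff_symMonomial (a b : Fin n) (s : Sym2 (Fin n)) :
    coeff (Finsupp.single a 1 + Finsupp.single b 1)
      ((s.map X).mul : MvPolynomial (Fin n) K) = if s = s(a, b) then 1 else 0 := by
  induction s with
  | _ i j =>
    rw [symMonomial_eq, coeff_monomial]
    congr 1
    rw [Finsupp.single_add_single_eq_single_add_single one_ne_zero one_ne_zero]
    simp

lemma sum_smul_symUnit (M : symmetricMatrices K n) :
    ∑ s : Sym2 (Fin n), (Sym2.lift ⟨fun i j => (M : Matrix (Fin n) (Fin n) K) i j,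
      fun i j => (M.2.apply i j).symm⟩ s) • symUnit K s = M := by
  ext i j
  simp [Matrix.sum_apply, symUnit_apply]

/-- The coefficients are the values on the matrices `symUnit`, which span; no division by 2 occurs.
-/
lemma dualToQuadratic_injective : Function.Injective (dualToQuadratic K n) := by
  rw [injective_iff_map_eq_zero]
  intro f hf
  have h : ∀ s, f (symUnit K s) = 0 := by
    intro s
    induction s with
    | _ a b =>
      have := congrArg (coeff (Finsupp.single a 1 + Finsupp.single b 1)) hf
      simpa [dualToQuadratic_apply, coeff_sum, coeff_smul, coeff_symMonomial] using this
  ext M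
  rw [← sum_smul_symUnit M, map_sum]
  simp [h]

end Duality

/-! ### From range-compatible maps to the polynomial theorem -/

lemma exists_eq_dotProduct_of_ker_le {K V : Type*} [Field K] [AddCommGroup V] [Module K V] {n : ℕ}
    (f : V →ₗ[K] (Fin n → K)) (g : Module.Dual K V) (h : ∀ v, f v = 0 → g v = 0) :
    ∃ x, ∀ v, g v = f v ⬝ᵥ x := by
  have hg : g ∈ LinearMap.range f.dualMap := by
    rw [LinearMap.range_dualMap_eq_dualAnnihilator_ker, Submodule.mem_dualAnnihilator]
    exact fun v hv => h v (LinearMap.mem_ker.1 hv)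
  obtain ⟨k, rfl⟩ := hg
  obtain ⟨x, rfl⟩ := (dotProductEquiv K (Fin n)).surjective k
  exact ⟨x, fun v => dotProduct_comm x (f v)⟩

lemma exists_local_of_rangeCompatible {K : Type*} [Field K] (hK : 2 < ENat.card K) {n : ℕ}
    {S : Submodule K (symmetricMatrices K n)}
    (hS : Module.finrank K (symmetricMatrices K n ⧸ S) + 2 ≤ n)
    (F : S →ₗ[K] (Fin n → K))
    (hF : ∀ M : S, ∃ u, F M = (M : Matrix (Fin n) (Fin n) K).mulVec u) :
    ∃ x, ∀ M : S, F M = (M : Matrix (Fin n) (Fin n) K).mulVec x := by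
  obtain ⟨c, hc0, hc1⟩ := exists_ne_zero_ne_one hK
  obtain ⟨G, hG⟩ := F.exists_extend
  replace hG : ∀ M : S, G M = F M := fun M => LinearMap.congr_fun hG M
  let D := S.dualAnnihilator.map (dualToQuadratic K n)
  let φ : (Fin n → K) →ₗ[K] MvPolynomial (Fin n) K :=
    dualToQuadratic K n ∘ₗ G.dualMap ∘ₗ dotProductBilin K K
  have hφ : ∀ y x, φ y - linForm K n y * linForm K n x ∈ D ↔
      ∀ M : S, y ⬝ᵥ F M = y ⬝ᵥ (M : Matrix (Fin n) (Fin n) K).mulVec x := by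
    intro y x
    have h : φ y - linForm K n y * linForm K n x
        = dualToQuadratic K n (G.dualMap (dotProductBilin K K y) - pairing y x) := by
      rw [map_sub, dualToQuadratic_pairing]
      rfl
    rw [h, ← Submodule.mem_comap, Submodule.comap_map_eq_of_injective dualToQuadratic_injective,
      Submodule.mem_dualAnnihilator]
    refine Iff.trans ?_ Subtype.forall.symm
    refine forall₂_congr fun M hM => ?_
    rw [LinearMap.sub_apply, sub_eq_zero, ← hG ⟨M, hM⟩]
    rfl
  have hD : Module.finrank K D ≤ Module.finrank K (symmetricMatrices K n ⧸ S) := by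
    refine (Submodule.finrank_map_le _ _).trans ?_
    have h1 := Subspace.finrank_add_finrank_dualAnnihilator_eq S
    have h2 := S.finrank_quotient_add_finrank
    lia
  have hlocal : ∀ y, ∃ x, φ y - linForm K n y * linForm K n x ∈ D := by
    intro y
    simp only [hφ]
    let f : S →ₗ[K] (Fin n → K) :=
      { toFun := fun M => (M : Matrix (Fin n) (Fin n) K).mulVec y
        map_add' := fun M N => by simp [Matrix.add_mulVec]
        map_smul' := fun a M => by simp [Matrix.smul_mulVec] }
    have hsymm : ∀ (M : S) (u : Fin n → K),
        y ⬝ᵥ (M : Matrix (Fin n) (Fin n) K).mulVec u = f M ⬝ᵥ u := by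
      intro M u
      have hM : (M : Matrix (Fin n) (Fin n) K).transpose = M := M.1.2
      rw [Matrix.dotProduct_mulVec, ← Matrix.mulVec_transpose, hM]
      rfl
    let g : Module.Dual K S := dotProductBilin K K y ∘ₗ F
    -- If `M y = 0` then, by symmetry, `y` is orthogonal to the range of `M`, which contains `F M`.
    have hg : ∀ M, f M = 0 → g M = 0 := by
      intro M hM
      obtain ⟨u, hu⟩ := hF M
      change y ⬝ᵥ F M = 0
      rw [hu, hsymm, hM, zero_dotProduct]
    obtain ⟨x, hx⟩ := exists_eq_dotProduct_of_ker_le (V := S) f g hg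
    exact ⟨x, fun M => (hx M).trans (hsymm M x).symm⟩
  obtain ⟨x, hx⟩ := exists_eq_mul_mod hc0 hc1 φ (Module.finrank K D) ⊤ (fun y _ => hlocal y)
    (Submodule.finrank_mono inf_le_left) (by
      rw [finrank_top, Module.finrank_fin_fun]
      lia)
  refine ⟨x, fun M => ?_⟩
  refine dotProduct_eq _ _ fun y => ?_
  rw [dotProduct_comm, (hφ y x).1 (hx y trivial) M, dotProduct_comm]

theorem mainTheorem5 {K : Type*} [Field K] (hK : 2 < ENat.card K) (n : ℕ)
    (S : Submodule K (Matrix (Fin n) (Fin n) K)) (hS : S ≤ symmetricMatrices K n)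
    (hcodim : (codimIn S (symmetricMatrices K n) : ℤ) ≤ (n : ℤ) - 2)
    (F : operatorSpace S →ₗ[K] (Fin n → K))
    (hF : IsRangeCompatible (S := (operatorSpace S : Set ((Fin n → K) →ₗ[K] (Fin n → K)))) F) :
    IsLocalMap (S := (operatorSpace S : Set ((Fin n → K) →ₗ[K] (Fin n → K)))) F := by
  let e : S.submoduleOf (symmetricMatrices K n) →ₗ[K] operatorSpace S :=
    (Matrix.toLin'.toLinearMap ∘ₗ (symmetricMatrices K n).subtype ∘ₗ
      (S.submoduleOf (symmetricMatrices K n)).subtype).codRestrict _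
      fun M => Submodule.mem_map_of_mem M.2
  have hcodim' : Module.finrank K (symmetricMatrices K n ⧸ S.submoduleOf (symmetricMatrices K n))
      + 2 ≤ n := by
    rw [codimIn] at hcodim
    lia
  obtain ⟨x, hx⟩ := exists_local_of_rangeCompatible hK hcodim' (F ∘ₗ e) fun M => by
    obtain ⟨u, hu⟩ := hF (e M)
    exact ⟨u, hu.symm.trans (Matrix.toLin'_apply _ _)⟩
  refine ⟨x, ?_⟩
  rintro ⟨_, M, hM, rfl⟩
  exact (hx ⟨⟨M, hS hM⟩, hM⟩).trans (Matrix.toLin'_apply _ _).symm
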